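/- Let $V$ be a discrete valuation ring with normalized valuation $\mathbf v$ and quotient field $K$, and let $R\subseteq V$ be a Kunz domain with integral closure $V$: that is, $R$ is a Noetherian local subring of $V$ with quotient field $K$ and integral closure $V$ (in $K$), the conductor $(R:V)=\{x\in K\mid xV\subseteq R\}$ is nonzero, the inclusion $R\hookrightarrow V$ induces an isomorphism of residue fields, and the numerical semigroup $\mathbf v(R)=\{\mathbf v(r)\mid r\in R\setminus\{0\}\}$ is pseudo-symmetric. (A numerical semigroup $S$ with $g=\max(\mathbb Z\setminus S)$ is pseudo-symmetric if $g$ is even and, for every $a\in\mathbb N$ with $a\neq g/2$, either $a\in S$ or $g-a\in S$.) A fractional ideal of $R$ is an $R$-submodule $I$ of $K$ with $xI\subseteq R$ for some $x\in K\setminus\{0\}$. A star operation on $R$ is a map $I\mapsto I^\star$ from the set of fractional ideals of $R$ to itself such that, for all fractional ideals $I,J$ and all $x\in K$: $I\subseteq I^\star$; if $I\subseteq J$ then $I^\star\subseteq J^\star$; $(I^\star)^\star=I^\star$; $x\cdot I^\star=(xI)^\star$; and $R^\star=R$. Let $\mathrm{Star}(R)$ be the set of star operations on $R$. Let $n\geq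 4$ be an integer, suppose that $\mathbf v(R)=\langle n,n+1,\ldots,2n-3,2n-1\rangle$ (the submonoid of $\mathbb N$ generated by these integers), and suppose that the residue field of $R$ is finite, of cardinality $q$. Then $$|\mathrm{Star}(R)|\;\geq\;2^{\frac{q^{n-2}-1}{q-1}}\;\geq\;2^{q^{n-3}}.$$ -/

import Mathlib

open scoped nonZeroDivisors

/-- A star operation on a domain `D` with quotient field `K`, as a self-map of the set of
fractional ideals of `D`. The product `spanSingleton D⁰ x * I` is `x · I`, and `1` is `D`. -/
structure IsStarOperation (D K : Type*) [CommRing D] [Field K] [Algebra D K] [IsFractionRing D K]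
    (s : FractionalIdeal D⁰ K → FractionalIdeal D⁰ K) : Prop where
  le_star : ∀ I, I ≤ s I
  mono : ∀ I J, I ≤ J → s I ≤ s J
  star_star : ∀ I, s (s I) = s I
  smul_star : ∀ (x : K) (I : FractionalIdeal D⁰ K),
    FractionalIdeal.spanSingleton D⁰ x * s I = s (FractionalIdeal.spanSingleton D⁰ x * I)
  star_one : s 1 = 1

/-- The set `Star(D)` of star operations on `D`. -/
def starOperations (D K : Type*) [CommRing D] [Field K] [Algebra D K] [IsFractionRing D K] :
    Set (FractionalIdeal D⁰ K → FractionalIdeal D⁰ K) :=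
  {s | IsStarOperation D K s}

/-- A submonoid `S` of `ℕ` is a pseudo-symmetric numerical semigroup if `g = max (ℤ \ S)` exists
(that is, `ℕ \ S` is finite), `g` is even, and for all natural numbers `a ≠ g / 2` one has
`a ∈ S` or `g - a ∈ S`. -/
def IsPseudoSymmetric (S : AddSubmonoid ℕ) : Prop :=
  ∃ g : ℤ, IsGreatest {z : ℤ | ¬ ∃ m ∈ S, (m : ℤ) = z} g ∧ Even g ∧
    ∀ a : ℕ, (a : ℤ) ≠ g / 2 → a ∈ S ∨ ∃ m ∈ S, (m : ℤ) = g - a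

/-- The set of values `{v(r) | r ∈ R, r ≠ 0}` of a ring `R` inside a discrete valuation ring `V`
with normalized valuation `v` (recall `v 0 = ⊤`). -/
noncomputable def valueSemigroup (R V : Type*) [CommRing R] [CommRing V] [IsDomain V]
    [IsDiscreteValuationRing V] [Algebra R V] : AddSubmonoid ℕ where
  carrier := {m | ∃ r : R, IsDiscreteValuationRing.addVal V (algebraMap R V r) = (m : ℕ∞)}
  zero_mem' := ⟨1, by simp⟩
  add_mem' := by
    rintro a b ⟨r, hr⟩ ⟨s, hs⟩
    exact ⟨r * s, by rw [map_mul, IsDiscreteValuationRing.addVal_mul, hr, hs, Nat.cast_add]⟩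

/-- `R` is a Kunz domain with integral closure the discrete valuation ring `V`. Here `K` is a
common quotient field of `R` and `V`; since `V` is the integral closure of `R` in `K`, the map
`algebraMap R V` is injective and identifies `R` with a subring of `V`. -/
structure IsKunzDomain (R V K : Type*) [CommRing R] [IsLocalRing R] [CommRing V] [IsDomain V]
    [IsDiscreteValuationRing V] [Field K] [Algebra R V] [Algebra R K] [Algebra V K]
    [IsScalarTower R V K] [IsFractionRing R K] : Prop where
  isFractionRing : IsFractionRing V K
  isIntegralClosure : IsIntegralClosure V R K
  isNoetherianRing : IsNoetherianRing R
  /-- The conductor `(R : V) = {x ∈ K | x V ⊆ R}` is nonzero. -/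
  conductor_ne_zero :
    ∃ x : K, x ≠ 0 ∧ ∀ v : V, x * algebraMap V K v ∈ (algebraMap R K).range
  [isLocalHom : IsLocalHom (algebraMap R V)]
  residueField_bijective :
    Function.Bijective (IsLocalRing.ResidueField.map (algebraMap R V))
  isPseudoSymmetric : IsPseudoSymmetric (valueSemigroup R V)

/-!
Let `𝔪` be the maximal ideal of `V`. The semigroup consists of `0`, the integers `n, …, 2n - 3` and
all integers `≥ 2n - 1`. So the maximal ideal of `R` lies in `𝔪ⁿ`, and since the residue fields
agree, `𝔪²ⁿ⁻¹ ⊆ R` (`exists_algebraMap_eq_of_mem_maximalIdeal_pow`). In particular `V / 𝔪ⁿ` is an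
algebra over the residue field `k` of `R`, with `q ^ n` elements.

For `w ∈ 𝔪` outside `𝔪ⁿ⁻¹`, consider the fractional ideal `I_w = R + R w + 𝔪ⁿ`, and let `p` have
value `n - 1`. Then `p ∉ I_w`. If `x I_w ⊆ R`, then `x` is a nonunit of `R`, as `w ∉ R`, and so
`x p ∈ 𝔪²ⁿ⁻¹ ⊆ R`. If `x I_w ⊆ I_w'`, then `x ∈ V`; either `x` is a nonunit and `x p ∈ 𝔪ⁿ ⊆ I_w'`,
or `x` is a unit, and comparing `x` and `x w` with elements of `I_w'` gives
`w (1 + c w') ≡ β w'` modulo `𝔪ⁿ` for some `c ∈ R` and some unit `β` of `R`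
(`mul_mem_pairSubmodule_of_not_moebius`). The last condition is an equivalence relation,
`moebiusSetoid`. Among pairwise inequivalent `w`, therefore, `p` is in the closure of `I_w` under
the star operation generated by any set of other `I_w'`, whereas `I_w` is closed under any star
operation that it helps to generate; so distinct sets of classes generate distinct star operations
(`two_pow_card_le_mk_starOperations`).

It remains to count classes (`exists_pairwise_not_moebius`). Modulo `𝔪ⁿ` there are
`q ^ (n - 1) - q` elements `w`, and an equivalence class has at most `(q - 1) q` elements, because
`w` is determined by `w'` and the residues of `β` and `c`. The quotient is
`(q ^ (n - 2) - 1) / (q - 1)`.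
-/

/-! ### Star operations cut out by families of fractional ideals -/

universe w

section StarClosure

variable {D K : Type*} [CommRing D] [Field K] [Algebra D K]

/-- The star operation generated by a set `Δ` of fractional ideals: `z` belongs to the closure of
`I` when every `A` in `{0, D} ∪ Δ` and every `x` with `x I ⊆ A` satisfy `x z ∈ A`. For `I ≠ 0`
this is the intersection of the multiples `x⁻¹ A ⊇ I` with `A ∈ {D} ∪ Δ` and `x ≠ 0`; the member
`A = 0` only serves to make `0` closed. -/
def starClosure (Δ : Set (FractionalIdeal D⁰ K)) (I : FractionalIdeal D⁰ K) :
    FractionalIdeal D⁰ K :=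
  ⟨{ carrier := {z | ∀ A ∈ insert 0 (insert 1 Δ), ∀ x : K, (∀ y ∈ I, x * y ∈ A) → x * z ∈ A}
     zero_mem' := fun A _ x _ => by
      rw [mul_zero]
      exact A.zero_mem
     add_mem' := fun {a b} ha hb A hA x hx => by
      rw [mul_add]
      exact (A : Submodule D K).add_mem (ha A hA x hx) (hb A hA x hx)
     smul_mem' := fun r a ha A hA x hx => by
      rw [mul_smul_comm]
      exact (A : Submodule D K).smul_mem r (ha A hA x hx) }, by
    obtain ⟨a, ha, h⟩ := I.isFractional
    refine ⟨a, ha, fun z hz => ?_⟩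
    have := hz 1 (by simp) (algebraMap D K a) fun y hy => by
      obtain ⟨r, hr⟩ := h y hy
      exact (FractionalIdeal.mem_one_iff D⁰).2 ⟨r, by rw [hr, Algebra.smul_def]⟩
    obtain ⟨r, hr⟩ := (FractionalIdeal.mem_one_iff D⁰).1 this
    exact ⟨r, by rw [hr, Algebra.smul_def]⟩⟩

theorem mem_starClosure {Δ : Set (FractionalIdeal D⁰ K)} {I : FractionalIdeal D⁰ K} {z : K} :
    z ∈ starClosure Δ I ↔
      ∀ A ∈ insert 0 (insert 1 Δ), ∀ x : K, (∀ y ∈ I, x * y ∈ A) → x * z ∈ A :=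
  Iff.rfl

theorem le_starClosure (Δ : Set (FractionalIdeal D⁰ K)) (I : FractionalIdeal D⁰ K) :
    I ≤ starClosure Δ I :=
  fun z hz _ _ _ hx => hx z hz

theorem starClosure_eq_self {Δ : Set (FractionalIdeal D⁰ K)} {A : FractionalIdeal D⁰ K}
    (hA : A ∈ insert 0 (insert 1 Δ)) : starClosure Δ A = A := by
  refine le_antisymm (fun z hz => ?_) (le_starClosure Δ A)
  have := hz A hA 1 fun y hy => by rwa [one_mul]
  rwa [one_mul] at this

theorem isStarOperation_starClosure [IsFractionRing D K] (Δ : Set (FractionalIdeal D⁰ K)) :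
    IsStarOperation D K (starClosure Δ) where
  le_star := le_starClosure Δ
  mono _ _ hIJ _ hz A hA x hx := hz A hA x fun y hy => hx y (hIJ hy)
  star_star I := le_antisymm
    (fun _ hz A hA x hx => hz A hA x fun _ hy => hy A hA x hx) (le_starClosure Δ _)
  smul_star c I := by
    rcases eq_or_ne c 0 with rfl | hc
    · rw [FractionalIdeal.spanSingleton_zero, zero_mul, zero_mul]
      refine (le_antisymm (fun z hz => ?_) (le_starClosure Δ 0)).symm
      have := hz 0 (Set.mem_insert _ _) 1 fun y hy => by rwa [one_mul]
      rwa [one_mul] at this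
    · ext z
      rw [FractionalIdeal.mem_singleton_mul]
      constructor
      · rintro ⟨y, hy, rfl⟩ A hA x hx
        rw [← mul_assoc]
        exact hy A hA (x * c) fun w hw => by
          rw [mul_assoc]
          exact hx _ (FractionalIdeal.mem_singleton_mul.2 ⟨w, hw, rfl⟩)
      · intro hz
        refine ⟨c⁻¹ * z, fun A hA x hx => ?_, by rw [mul_inv_cancel_left₀ hc]⟩
        rw [← mul_assoc]
        refine hz A hA (x * c⁻¹) fun w hw => ?_
        obtain ⟨y, hy, rfl⟩ := FractionalIdeal.mem_singleton_mul.1 hw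
        rw [mul_assoc, inv_mul_cancel_left₀ hc]
        exact hx y hy
  star_one := starClosure_eq_self (by simp)

/-- If every `f i` has an element `y i` outside it that lies in every multiple of `D` or of some
`f j`, `j ≠ i`, containing `f i`, then distinct sets of indices generate distinct star
operations. -/
theorem two_pow_card_le_mk_starOperations [IsFractionRing D K] {ι : Type w} [Finite ι]
    (f : ι → FractionalIdeal D⁰ K) (y : ι → K) (hf : ∀ i, (1 : K) ∈ f i) (hy : ∀ i, y i ∉ f i)
    (h1 : ∀ i, ∀ x : K, (∀ z ∈ f i, x * z ∈ (1 : FractionalIdeal D⁰ K)) →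
      x * y i ∈ (1 : FractionalIdeal D⁰ K))
    (hne : ∀ i j, i ≠ j → ∀ x : K, (∀ z ∈ f i, x * z ∈ f j) → x * y i ∈ f j) :
    ((2 ^ Nat.card ι : ℕ) : Cardinal) ≤ Cardinal.mk (starOperations D K) := by
  let F : Set ι → starOperations D K := fun Δ =>
    ⟨starClosure (f '' Δ), isStarOperation_starClosure _⟩
  have key : ∀ Δ Δ' : Set ι, F Δ = F Δ' → Δ ⊆ Δ' := by
    intro Δ Δ' h i hi
    by_contra hi'
    have hcl : starClosure (f '' Δ) (f i) = f i :=
      starClosure_eq_self (.inr (.inr ⟨i, hi, rfl⟩))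
    have h' : starClosure (f '' Δ) = starClosure (f '' Δ') := congrArg Subtype.val h
    refine hy i ?_
    rw [← hcl, h', mem_starClosure]
    rintro A (rfl | rfl | ⟨j, hj, rfl⟩) x hx
    · have := (FractionalIdeal.mem_zero_iff D⁰).1 (hx 1 (hf i))
      rw [mul_one] at this
      rw [this, zero_mul]
      exact FractionalIdeal.zero_mem _
    · exact h1 i x hx
    · exact hne i j (fun e => hi' (e ▸ hj)) x hx
  have hinj : Function.Injective F := fun Δ Δ' h =>
    Set.Subset.antisymm (key _ _ h) (key _ _ h.symm)
  have := Cardinal.lift_mk_le_lift_mk_of_injective hinj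
  have hcard : Cardinal.mk (Set ι) = ((2 ^ Nat.card ι : ℕ) : Cardinal) := by
    rw [Cardinal.mk_set, Nat.cast_pow, Nat.cast_ofNat, ← Cardinal.power_natCast, Nat.cast_card]
  rw [hcard, Cardinal.lift_natCast] at this
  rw [← Cardinal.lift_le.{w}, Cardinal.lift_natCast]
  exact this

end StarClosure

/-! ### Pairwise inequivalent elements of a finite set -/

/-- A finite set whose elements have at most `m` equivalents each contains a set of pairwise
inequivalent elements of at least `1 / m` of its size. -/
theorem Finset.exists_subset_pairwise_not_rel {α : Type*} (r : Setoid α) (s : Finset α) (m : ℕ)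
    (hm : ∀ a ∈ s, {b | b ∈ s ∧ r b a}.ncard ≤ m) :
    ∃ t ⊆ s, (∀ a ∈ t, ∀ b ∈ t, r a b → a = b) ∧ s.card ≤ m * t.card := by
  classical
  have h1 : s.card ≤ m * (s.image (Quotient.mk r)).card := by
    refine Finset.card_le_mul_card_image s m fun i hi => ?_
    obtain ⟨a, ha, rfl⟩ := Finset.mem_image.1 hi
    refine le_trans (le_of_eq ?_) (hm a ha)
    rw [← Set.ncard_coe_finset]
    congr 1
    ext b
    simpa using fun _ => Quotient.eq
  obtain ⟨t, ht, hinj, himg⟩ := Finset.exists_subset_injOn_image_eq_of_surjOn (f := Quotient.mk r)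
    s (s.image (Quotient.mk r)) (by rw [Finset.coe_image]; exact Set.surjOn_image _ _)
  refine ⟨t, by exact_mod_cast ht, fun a ha b hb h => hinj ha hb (Quotient.sound h), ?_⟩
  rwa [← himg, Finset.card_image_of_injOn hinj] at h1

/-! ### A Möbius equivalence relation on an algebra -/

section Moebius

variable (R : Type*) {B : Type*} [CommRing R] [CommRing B] [Algebra R B]

/-- The relation `b (1 + c b') = β b'` for some `c` and some unit `β` of `R`: formally, `b` arises
from `b'` by the fractional linear transformation `β b' / (1 + c b')`. The factor
`1 + c b'` then maps the `R`-module `⟨1, b⟩` onto `⟨1, b'⟩`. -/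
def moebiusSetoid : Setoid B where
  r b b' := ∃ c β : R, IsUnit β ∧ b * (1 + c • b') = β • b'
  iseqv := by
    refine ⟨fun b => ⟨0, 1, isUnit_one, by simp⟩, ?_, ?_⟩
    · rintro b b' ⟨c, β, hβ, h⟩
      obtain ⟨u, rfl⟩ := hβ
      refine ⟨-(↑u⁻¹ * c), ↑u⁻¹, Units.isUnit _, ?_⟩
      have hu : algebraMap R B u * algebraMap R B ↑u⁻¹ = 1 := by
        rw [← map_mul, Units.mul_inv, map_one]
      simp only [Algebra.smul_def, map_neg, map_mul] at h ⊢
      linear_combination (-algebraMap R B ↑u⁻¹) * h - b' * hu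
    · rintro b b' b'' ⟨c, β, hβ, h⟩ ⟨d, γ, hγ, h'⟩
      refine ⟨d + c * γ, β * γ, hβ.mul hγ, ?_⟩
      simp only [Algebra.smul_def, map_add, map_mul] at h h' ⊢
      linear_combination (1 + algebraMap R B d * b'') * h +
        (algebraMap R B β - algebraMap R B c * b) * h'

variable {R}

/-- If the algebra structure on `B` factors through the residue field `k` of `R`, a class of
`moebiusSetoid` has at most `|kˣ| |k|` elements: they are determined by the residues of the two
coefficients. -/
theorem ncard_moebius_le [IsLocalRing R] [Finite (IsLocalRing.ResidueField R)]
    (hM : ∀ r ∈ IsLocalRing.maximalIdeal R, algebraMap R B r = 0) (a : B)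
    (ha : ∀ c : R, IsUnit (1 + c • a)) :
    {b | moebiusSetoid R b a}.ncard ≤ (Nat.card (IsLocalRing.ResidueField R) - 1) *
      Nat.card (IsLocalRing.ResidueField R) := by
  have hM' : ∀ r s : R, IsLocalRing.residue R r = IsLocalRing.residue R s →
      algebraMap R B r = algebraMap R B s := by
    intro r s h
    rw [← sub_eq_zero, ← map_sub, IsLocalRing.residue_eq_zero_iff] at h
    rw [← sub_eq_zero, ← map_sub, hM _ h]
  choose c β hβ h using fun b : {b | moebiusSetoid R b a} => b.2
  rw [← Nat.card_coe_set_eq, ← Nat.card_units, ← Nat.card_prod]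
  refine Nat.card_le_card_of_injective
    (fun b => ((hβ b).unit.map (IsLocalRing.residue R).toMonoidHom,
      IsLocalRing.residue R (c b))) fun b b' hb => ?_
  have h1 : algebraMap R B (β b) = algebraMap R B (β b') :=
    hM' _ _ (congrArg Units.val (congrArg Prod.fst hb))
  have h2 : algebraMap R B (c b) = algebraMap R B (c b') := hM' _ _ (congrArg Prod.snd hb)
  refine Subtype.ext ((ha (c b)).mul_right_cancel ?_)
  rw [h b, Algebra.smul_def (c b), h2, ← Algebra.smul_def (c b'), h b', Algebra.smul_def,
    Algebra.smul_def, h1]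

end Moebius

/-! ### Powers of the maximal ideal of a discrete valuation ring -/

section DVR

open IsDiscreteValuationRing

variable {V : Type*} [CommRing V] [IsDomain V] [IsDiscreteValuationRing V]

theorem mem_maximalIdeal_pow_iff_le_addVal {n : ℕ} {v : V} :
    v ∈ IsLocalRing.maximalIdeal V ^ n ↔ (n : ℕ∞) ≤ addVal V v := by
  obtain ⟨ϖ, h⟩ := exists_irreducible V
  rw [h.maximalIdeal_eq, Ideal.span_singleton_pow, Ideal.mem_span_singleton,
    ← addVal_le_iff_dvd, h.addVal_pow]

theorem card_quotient_maximalIdeal_pow (n : ℕ) :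
    Nat.card (V ⧸ IsLocalRing.maximalIdeal V ^ n) =
      Nat.card (IsLocalRing.ResidueField V) ^ n :=
  cardQuot_pow_of_prime (IsDiscreteValuationRing.not_a_field V)

theorem finite_quotient_maximalIdeal_pow [Finite (IsLocalRing.ResidueField V)] (n : ℕ) :
    Finite (V ⧸ IsLocalRing.maximalIdeal V ^ n) := by
  refine Nat.finite_of_card_ne_zero ?_
  rw [card_quotient_maximalIdeal_pow]
  exact pow_ne_zero _ Nat.card_pos.ne'

theorem card_map_maximalIdeal_pow [Finite (IsLocalRing.ResidueField V)] {i n : ℕ} (h : i ≤ n) :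
    Nat.card ((IsLocalRing.maximalIdeal V ^ i).map
        (Ideal.Quotient.mk (IsLocalRing.maximalIdeal V ^ n))) =
      Nat.card (IsLocalRing.ResidueField V) ^ (n - i) := by
  have h1 := Submodule.card_quotient_mul_card_quotient (IsLocalRing.maximalIdeal V ^ i)
    (IsLocalRing.maximalIdeal V ^ n) (Ideal.pow_le_pow_right h)
  rw [card_quotient_maximalIdeal_pow, card_quotient_maximalIdeal_pow] at h1
  have h2 : Nat.card (Submodule.map (IsLocalRing.maximalIdeal V ^ n).mkQ
      (IsLocalRing.maximalIdeal V ^ i)) = Nat.card ((IsLocalRing.maximalIdeal V ^ i).map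
        (Ideal.Quotient.mk (IsLocalRing.maximalIdeal V ^ n))) := by
    refine Nat.card_congr (Equiv.subtypeEquivRight fun x => ?_)
    rw [Ideal.mem_map_iff_of_surjective _ Ideal.Quotient.mk_surjective]
    rfl
  rw [h2] at h1
  refine Nat.eq_of_mul_eq_mul_right (pow_pos Nat.card_pos i) (h1.trans ?_)
  rw [← pow_add, Nat.sub_add_cancel h]

end DVR

/-! ### The fractional ideals spanned by two elements modulo a power of the maximal ideal -/

section PairIdeal

variable {R V K : Type*} [CommRing R] [CommRing V] [IsDomain V]
    [IsDiscreteValuationRing V] [Field K] [Algebra R V] [Algebra R K] [Algebra V K]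
    [IsScalarTower R V K]

variable (R K) in
/-- The `R`-submodule `R + R w + 𝔪ⁿ` of `K`, where `𝔪` is the maximal ideal of `V` and `b` is the
class of `w` modulo `𝔪ⁿ`. -/
def pairSubmodule {n : ℕ} (b : V ⧸ IsLocalRing.maximalIdeal V ^ n) : Submodule R K :=
  ((Submodule.span R {1, b}).comap
    (Ideal.Quotient.mkₐ R (IsLocalRing.maximalIdeal V ^ n)).toLinearMap).map
    (IsScalarTower.toAlgHom R V K).toLinearMap

theorem mem_pairSubmodule {n : ℕ} {b : V ⧸ IsLocalRing.maximalIdeal V ^ n} {z : K} :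
    z ∈ pairSubmodule R K b ↔ ∃ v : V, (∃ a c : R, a • 1 + c • b =
      Ideal.Quotient.mk (IsLocalRing.maximalIdeal V ^ n) v) ∧ algebraMap V K v = z := by
  simp only [pairSubmodule, Submodule.mem_map, Submodule.mem_comap, Submodule.mem_span_pair]
  rfl

theorem algebraMap_mem_pairSubmodule (hVK : Function.Injective (algebraMap V K)) {n : ℕ}
    {b : V ⧸ IsLocalRing.maximalIdeal V ^ n} {v : V} :
    algebraMap V K v ∈ pairSubmodule R K b ↔ ∃ a c : R, a • 1 + c • b =
      Ideal.Quotient.mk (IsLocalRing.maximalIdeal V ^ n) v := by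
  rw [mem_pairSubmodule]
  constructor
  · rintro ⟨v', h, hv⟩
    rwa [← hVK hv]
  · exact fun h => ⟨v, h, rfl⟩

theorem isFractional_pairSubmodule {r : R} (hr : r ∈ R⁰)
    (hrV : ∀ v : V, ∃ s : R, algebraMap R V s = algebraMap R V r * v) {n : ℕ}
    (b : V ⧸ IsLocalRing.maximalIdeal V ^ n) : IsFractional R⁰ (pairSubmodule R K b) := by
  refine ⟨r, hr, fun z hz => ?_⟩
  obtain ⟨v, -, rfl⟩ := mem_pairSubmodule.1 hz
  obtain ⟨s, hs⟩ := hrV v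
  refine ⟨s, ?_⟩
  rw [IsScalarTower.algebraMap_apply R V K, hs, map_mul, Algebra.smul_def,
    ← IsScalarTower.algebraMap_apply]

variable [IsLocalRing R]

theorem smul_quotient_eq_zero {n : ℕ} (hM : ∀ r ∈ IsLocalRing.maximalIdeal R,
    algebraMap R V r ∈ IsLocalRing.maximalIdeal V ^ n) {r : R}
    (hr : r ∈ IsLocalRing.maximalIdeal R) (b : V ⧸ IsLocalRing.maximalIdeal V ^ n) :
    r • b = 0 := by
  rw [Algebra.smul_def]
  have : algebraMap R (V ⧸ IsLocalRing.maximalIdeal V ^ n) r = 0 :=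
    Ideal.Quotient.eq_zero_iff_mem.2 (hM r hr)
  rw [this, zero_mul]

theorem mem_maximalIdeal_of_smul_one_add_smul [IsLocalHom (algebraMap R V)] {n : ℕ} (hn : 1 ≤ n)
    {v w : V} (hv : v ∈ IsLocalRing.maximalIdeal V) (hw : w ∈ IsLocalRing.maximalIdeal V)
    {a c : R} (h : a • 1 + c • Ideal.Quotient.mk (IsLocalRing.maximalIdeal V ^ n) w =
      Ideal.Quotient.mk (IsLocalRing.maximalIdeal V ^ n) v) :
    a ∈ IsLocalRing.maximalIdeal R := by
  have h' : Ideal.Quotient.mk (IsLocalRing.maximalIdeal V ^ n)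
      (algebraMap R V a + algebraMap R V c * w) = Ideal.Quotient.mk _ v := by
    rw [← h, Algebra.smul_def, Algebra.smul_def, mul_one, map_add, map_mul]
    rfl
  have h2 := Ideal.pow_le_self (by omega) (Ideal.Quotient.eq.1 h')
  have h3 : algebraMap R V a ∈ IsLocalRing.maximalIdeal V := by
    have e : algebraMap R V a =
        (algebraMap R V a + algebraMap R V c * w - v) + v - algebraMap R V c * w := by ring
    rw [e]
    exact sub_mem (add_mem h2 hv) (Ideal.mul_mem_left _ _ hw)
  rw [IsLocalRing.mem_maximalIdeal] at h3 ⊢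
  exact fun ha => h3 (ha.map _)

/-- An element of value exactly `n - 1` is not in `R + R w + 𝔪ⁿ` if `0 < v(w) < n - 1`. -/
theorem algebraMap_notMem_pairSubmodule [IsLocalHom (algebraMap R V)]
    (hVK : Function.Injective (algebraMap V K)) {n : ℕ} (hn : 2 ≤ n)
    (hM : ∀ r ∈ IsLocalRing.maximalIdeal R, algebraMap R V r ∈ IsLocalRing.maximalIdeal V ^ n)
    {w p : V} (hw : w ∈ IsLocalRing.maximalIdeal V)
    (hw' : w ∉ IsLocalRing.maximalIdeal V ^ (n - 1))
    (hp : p ∈ IsLocalRing.maximalIdeal V ^ (n - 1)) (hp' : p ∉ IsLocalRing.maximalIdeal V ^ n) :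
    algebraMap V K p ∉
      pairSubmodule R K (Ideal.Quotient.mk (IsLocalRing.maximalIdeal V ^ n) w) := by
  rw [algebraMap_mem_pairSubmodule hVK]
  rintro ⟨a, c, h⟩
  have ha := mem_maximalIdeal_of_smul_one_add_smul (by omega)
    (Ideal.pow_le_self (by omega) hp) hw h
  rw [smul_quotient_eq_zero hM ha, zero_add] at h
  by_cases hc : IsUnit c
  · obtain ⟨u, rfl⟩ := hc
    have h2 : Ideal.Quotient.mk (IsLocalRing.maximalIdeal V ^ n) w =
        Ideal.Quotient.mk _ (algebraMap R V ↑u⁻¹ * p) := by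
      have h3 := congrArg (fun x => (↑u⁻¹ : R) • x) h
      simp only [smul_smul, Units.inv_mul, one_smul] at h3
      rw [h3, Algebra.smul_def, map_mul]
      rfl
    have h4 := Ideal.pow_le_pow_right (Nat.sub_le n 1) (Ideal.Quotient.eq.1 h2)
    exact hw' (by simpa using add_mem h4 (Ideal.mul_mem_left _ (algebraMap R V ↑u⁻¹) hp))
  · rw [smul_quotient_eq_zero hM ((IsLocalRing.mem_maximalIdeal c).2 hc)] at h
    exact hp' (Ideal.Quotient.eq_zero_iff_mem.1 h.symm)

/-- If a multiple of `R + R w + 𝔪ⁿ` lies in `R`, the multiplier is a nonunit of `R`, so it carries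
`𝔪ⁿ⁻¹` into `𝔪²ⁿ⁻¹ ⊆ R`. -/
theorem exists_algebraMap_eq_mul_of_forall_mem_pairSubmodule [IsLocalHom (algebraMap R V)]
    (hVK : Function.Injective (algebraMap V K)) {n : ℕ} (hn : 2 ≤ n)
    (hM : ∀ r ∈ IsLocalRing.maximalIdeal R, algebraMap R V r ∈ IsLocalRing.maximalIdeal V ^ n)
    (hC : ∀ v ∈ IsLocalRing.maximalIdeal V ^ (2 * n - 1), ∃ r : R, algebraMap R V r = v)
    {w p : V} (hw : w ∈ IsLocalRing.maximalIdeal V)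
    (hw' : w ∉ IsLocalRing.maximalIdeal V ^ (n - 1))
    (hp : p ∈ IsLocalRing.maximalIdeal V ^ (n - 1)) {x : K}
    (hx : ∀ z ∈ pairSubmodule R K (Ideal.Quotient.mk (IsLocalRing.maximalIdeal V ^ n) w),
      ∃ r : R, algebraMap R K r = x * z) :
    ∃ r : R, algebraMap R K r = x * algebraMap V K p := by
  obtain ⟨r, hr⟩ := hx 1 (by
    rw [← map_one (algebraMap V K), algebraMap_mem_pairSubmodule hVK]
    exact ⟨1, 0, by simp⟩)
  rw [mul_one] at hr
  subst hr
  have hrM : r ∈ IsLocalRing.maximalIdeal R := by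
    rw [IsLocalRing.mem_maximalIdeal]
    rintro ⟨u, rfl⟩
    obtain ⟨s, hs⟩ := hx (algebraMap V K w) (by
      rw [algebraMap_mem_pairSubmodule hVK]
      exact ⟨0, 1, by simp⟩)
    have h2 : algebraMap R V (↑u⁻¹ * s) = w := by
      apply hVK
      rw [← IsScalarTower.algebraMap_apply, map_mul, hs, ← mul_assoc, ← map_mul, Units.inv_mul,
        map_one, one_mul]
    have h3 : (↑u⁻¹ * s) ∈ IsLocalRing.maximalIdeal R := by
      rw [← h2, IsLocalRing.mem_maximalIdeal] at hw
      exact (IsLocalRing.mem_maximalIdeal _).2 fun h => hw (h.map _)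
    exact hw' (Ideal.pow_le_pow_right (Nat.sub_le n 1) (h2 ▸ hM _ h3))
  obtain ⟨s, hs⟩ := hC (algebraMap R V r * p) (by
    have := Ideal.mul_mem_mul (hM r hrM) hp
    rwa [← pow_add, show n + (n - 1) = 2 * n - 1 by omega] at this)
  exact ⟨s, by rw [IsScalarTower.algebraMap_apply R V K, hs, map_mul,
    ← IsScalarTower.algebraMap_apply]⟩

/-- If a multiple of `R + R w + 𝔪ⁿ` lies in `R + R w' + 𝔪ⁿ`, either the multiplier lies in `𝔪`, and
then carries `𝔪ⁿ⁻¹` into `𝔪ⁿ`, or it is a unit of `V` and exhibits `w` and `w'` as equivalent. -/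
theorem mul_mem_pairSubmodule_of_not_moebius [IsLocalHom (algebraMap R V)]
    (hVK : Function.Injective (algebraMap V K)) {n : ℕ} (hn : 2 ≤ n)
    (hM : ∀ r ∈ IsLocalRing.maximalIdeal R, algebraMap R V r ∈ IsLocalRing.maximalIdeal V ^ n)
    {w w' p : V} (hw : w ∈ IsLocalRing.maximalIdeal V)
    (hw1 : w ∉ IsLocalRing.maximalIdeal V ^ (n - 1)) (hw' : w' ∈ IsLocalRing.maximalIdeal V)
    (hww' : ¬ moebiusSetoid R (Ideal.Quotient.mk (IsLocalRing.maximalIdeal V ^ n) w)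
      (Ideal.Quotient.mk (IsLocalRing.maximalIdeal V ^ n) w'))
    (hp : p ∈ IsLocalRing.maximalIdeal V ^ (n - 1)) {x : K}
    (hx : ∀ z ∈ pairSubmodule R K (Ideal.Quotient.mk (IsLocalRing.maximalIdeal V ^ n) w),
      x * z ∈ pairSubmodule R K (Ideal.Quotient.mk (IsLocalRing.maximalIdeal V ^ n) w')) :
    x * algebraMap V K p ∈
      pairSubmodule R K (Ideal.Quotient.mk (IsLocalRing.maximalIdeal V ^ n) w') := by
  have h1 := hx 1 (by
    rw [← map_one (algebraMap V K), algebraMap_mem_pairSubmodule hVK]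
    exact ⟨1, 0, by simp⟩)
  rw [mul_one] at h1
  obtain ⟨u, ⟨a, c, hac⟩, rfl⟩ := mem_pairSubmodule.1 h1
  by_cases hu : u ∈ IsLocalRing.maximalIdeal V
  · rw [← map_mul, algebraMap_mem_pairSubmodule hVK]
    refine ⟨0, 0, ?_⟩
    rw [zero_smul, zero_smul, add_zero, eq_comm, Ideal.Quotient.eq_zero_iff_mem]
    have := Ideal.mul_mem_mul hu hp
    rwa [← pow_succ', show n - 1 + 1 = n by omega] at this
  · refine absurd ?_ hww'
    have h2 := hx (algebraMap V K w) (by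
      rw [algebraMap_mem_pairSubmodule hVK]
      exact ⟨0, 1, by simp⟩)
    rw [← map_mul, algebraMap_mem_pairSubmodule hVK] at h2
    obtain ⟨α, β, h⟩ := h2
    have hα := mem_maximalIdeal_of_smul_one_add_smul (by omega) (Ideal.mul_mem_left _ u hw) hw' h
    rw [smul_quotient_eq_zero hM hα, zero_add, map_mul, ← hac] at h
    have ha : IsUnit a := by
      by_contra ha
      rw [smul_quotient_eq_zero hM ((IsLocalRing.mem_maximalIdeal a).2 ha), zero_add] at hac
      have h3 : Ideal.Quotient.mk (IsLocalRing.maximalIdeal V ^ n) (algebraMap R V c * w') =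
          Ideal.Quotient.mk _ u := by
        rw [← hac, Algebra.smul_def, map_mul]
        rfl
      have h4 := Ideal.pow_le_self (by omega) (Ideal.Quotient.eq.1 h3)
      exact hu (by simpa using sub_mem (Ideal.mul_mem_left _ (algebraMap R V c) hw') h4)
    have hβ : IsUnit β := by
      by_contra hβ
      rw [smul_quotient_eq_zero hM ((IsLocalRing.mem_maximalIdeal β).2 hβ), hac, ← map_mul,
        eq_comm, Ideal.Quotient.eq_zero_iff_mem] at h
      rw [IsLocalRing.notMem_maximalIdeal] at hu
      rw [Ideal.unit_mul_mem_iff_mem _ hu] at h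
      exact hw1 (Ideal.pow_le_pow_right (Nat.sub_le n 1) h)
    obtain ⟨a, rfl⟩ := ha
    refine ⟨↑a⁻¹ * c, ↑a⁻¹ * β, (Units.isUnit _).mul hβ, ?_⟩
    have hu1 : algebraMap R (V ⧸ IsLocalRing.maximalIdeal V ^ n) a *
        algebraMap R (V ⧸ IsLocalRing.maximalIdeal V ^ n) ↑a⁻¹ = 1 := by
      rw [← map_mul, Units.mul_inv, map_one]
    simp only [Algebra.smul_def, map_mul] at h ⊢
    linear_combination (-algebraMap R _ ↑a⁻¹) * h -
      Ideal.Quotient.mk (IsLocalRing.maximalIdeal V ^ n) w * hu1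

/-- The classes modulo `𝔪ⁿ` of the elements of `𝔪` outside `𝔪ⁿ⁻¹` contain at least
`1 + q + ⋯ + q ^ (n - 3)` pairwise inequivalent ones: there are `q ^ (n - 1) - q` of them, and
each is equivalent to at most `(q - 1) q`. -/
theorem exists_pairwise_not_moebius [IsLocalHom (algebraMap R V)] {n : ℕ} (hn : 2 ≤ n)
    (hM : ∀ r ∈ IsLocalRing.maximalIdeal R, algebraMap R V r ∈ IsLocalRing.maximalIdeal V ^ n)
    [Finite (IsLocalRing.ResidueField R)] {q : ℕ}
    (hqR : Nat.card (IsLocalRing.ResidueField R) = q)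
    (hqV : Nat.card (IsLocalRing.ResidueField V) = q) (hq : 2 ≤ q) :
    ∃ t : Finset (V ⧸ IsLocalRing.maximalIdeal V ^ n),
      (∀ b ∈ t, ∃ w ∈ IsLocalRing.maximalIdeal V, w ∉ IsLocalRing.maximalIdeal V ^ (n - 1) ∧
        Ideal.Quotient.mk (IsLocalRing.maximalIdeal V ^ n) w = b) ∧
      (∀ a ∈ t, ∀ b ∈ t, moebiusSetoid R a b → a = b) ∧
      (q ^ (n - 2) - 1) / (q - 1) ≤ t.card := by
  have hfin : Finite (IsLocalRing.ResidueField V) :=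
    Nat.finite_of_card_ne_zero (by omega)
  have hfinB : Finite (V ⧸ IsLocalRing.maximalIdeal V ^ n) := finite_quotient_maximalIdeal_pow n
  let mk := Ideal.Quotient.mk (IsLocalRing.maximalIdeal V ^ n)
  let I := (IsLocalRing.maximalIdeal V).map mk
  let J := (IsLocalRing.maximalIdeal V ^ (n - 1)).map mk
  have hI : Nat.card I = q ^ (n - 1) := by
    have := card_map_maximalIdeal_pow (V := V) (i := 1) (n := n) (by omega)
    rwa [pow_one, hqV] at this
  have hJ : Nat.card J = q := by
    have := card_map_maximalIdeal_pow (V := V) (i := n - 1) (n := n) (by omega)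
    rwa [hqV, show n - (n - 1) = 1 by omega, pow_one] at this
  have hJI : J ≤ I := Ideal.map_mono (Ideal.pow_le_self (by omega))
  let X : Set (V ⧸ IsLocalRing.maximalIdeal V ^ n) := (I : Set _) \ J
  have hX : X.ncard = q ^ (n - 1) - q := by
    rw [Set.ncard_sdiff (by exact_mod_cast hJI) (Set.toFinite _), ← Nat.card_coe_set_eq,
      ← Nat.card_coe_set_eq]
    exact congrArg₂ _ hI hJ
  have hXw : ∀ b ∈ X, ∃ w ∈ IsLocalRing.maximalIdeal V,
      w ∉ IsLocalRing.maximalIdeal V ^ (n - 1) ∧ mk w = b := by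
    rintro b ⟨hbI, hbJ⟩
    obtain ⟨w, hw, rfl⟩ :=
      (Ideal.mem_map_iff_of_surjective mk Ideal.Quotient.mk_surjective).1 hbI
    exact ⟨w, hw, fun h => hbJ (Ideal.mem_map_of_mem mk h), rfl⟩
  have hclass : ∀ a ∈ X.toFinite.toFinset,
      {b | b ∈ X.toFinite.toFinset ∧ moebiusSetoid R b a}.ncard ≤ (q - 1) * q := by
    intro a ha
    obtain ⟨w, hw, -, rfl⟩ := hXw a (X.toFinite.mem_toFinset.1 ha)
    have hsub : {b | b ∈ X.toFinite.toFinset ∧ moebiusSetoid R b (mk w)} ⊆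
      {b | moebiusSetoid R b (mk w)} := fun b hb => hb.2
    refine (Set.ncard_le_ncard hsub (Set.toFinite _)).trans ?_
    rw [← hqR]
    refine ncard_moebius_le (fun r hr => Ideal.Quotient.eq_zero_iff_mem.2 (hM r hr)) _ fun c => ?_
    have hunit : IsUnit (1 + algebraMap R V c * w) := by
      rw [← IsLocalRing.notMem_maximalIdeal]
      intro h
      have := sub_mem h (Ideal.mul_mem_left _ (algebraMap R V c) hw)
      rw [add_sub_cancel_right] at this
      exact (Ideal.ne_top_iff_one _).1 (IsLocalRing.maximalIdeal.isMaximal V).ne_top this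
    have h2 := hunit.map mk
    rw [map_add, map_one, map_mul] at h2
    rw [Algebra.smul_def]
    exact h2
  obtain ⟨t, htX, ht, hcard⟩ := Finset.exists_subset_pairwise_not_rel _ _ _ hclass
  refine ⟨t, fun b hb => hXw b (X.toFinite.mem_toFinset.1 (htX hb)), ht, ?_⟩
  rw [← Set.ncard_eq_toFinset_card X, hX] at hcard
  refine (Nat.div_le_iff_le_mul_add_pred (by omega)).2 ?_
  have h3 : q * (q ^ (n - 2) - 1) ≤ q * ((q - 1) * t.card) := by
    rw [Nat.mul_sub, mul_one, ← pow_succ', show n - 2 + 1 = n - 1 by omega]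
    exact hcard.trans (le_of_eq (by ring))
  exact (Nat.le_of_mul_le_mul_left h3 (by omega)).trans (Nat.le_add_right _ _)

end PairIdeal

/-! ### The value semigroup and the conductor -/

theorem AddSubmonoid.closure_Icc_union_singleton_eq_zero_or_le {n m : ℕ} (hn : 1 ≤ n)
    (h : m ∈ AddSubmonoid.closure (Set.Icc n (2 * n - 3) ∪ {2 * n - 1})) : m = 0 ∨ n ≤ m := by
  induction h using AddSubmonoid.closure_induction with
  | mem x hx =>
    rcases hx with hx | hx
    · exact .inr hx.1
    · rw [Set.mem_singleton_iff] at hx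
      omega
  | zero => exact .inl rfl
  | add x y _ _ hx hy => omega

theorem AddSubmonoid.mem_closure_Icc_union_singleton_of_le {n : ℕ} (hn : 4 ≤ n) (m : ℕ)
    (h : 2 * n - 1 ≤ m) : m ∈ AddSubmonoid.closure (Set.Icc n (2 * n - 3) ∪ {2 * n - 1}) := by
  have hI : ∀ a, n ≤ a → a ≤ 2 * n - 3 →
      a ∈ AddSubmonoid.closure (Set.Icc n (2 * n - 3) ∪ {2 * n - 1}) :=
    fun a h1 h2 => AddSubmonoid.subset_closure (.inl ⟨h1, h2⟩)
  have hS : 2 * n - 1 ∈ AddSubmonoid.closure (Set.Icc n (2 * n - 3) ∪ {2 * n - 1}) :=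
    AddSubmonoid.subset_closure (.inr rfl)
  induction m using Nat.strong_induction_on with
  | _ m ih =>
    obtain rfl | h1 := eq_or_lt_of_le h
    · exact hS
    · by_cases h2 : m ≤ 3 * n - 3
      · have := add_mem (hI n le_rfl (by omega)) (hI (m - n) (by omega) (by omega))
        rwa [show n + (m - n) = m by omega] at this
      · by_cases h3 : m = 3 * n - 2
        · have := add_mem (hI (n + 1) (by omega) (by omega)) (hI (2 * n - 3) (by omega) le_rfl)
          rwa [show n + 1 + (2 * n - 3) = m by omega] at this
        · have := add_mem (hI n le_rfl (by omega)) (ih (m - n) (by omega) (by omega))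
          rwa [show n + (m - n) = m by omega] at this

section Conductor

open IsDiscreteValuationRing

variable {R V : Type*} [CommRing R] [CommRing V] [IsDomain V] [IsDiscreteValuationRing V]
  [Algebra R V]

/-- If the residue field does not grow, all integers `≥ c` are values of `R`, and the conductor is
nonzero, then the conductor contains `𝔪ᶜ`: an element of value `m ≥ c` can be approximated by an
element of `R` up to an element of larger value, until the conductor is reached. -/
theorem exists_algebraMap_eq_of_mem_maximalIdeal_pow {r : R} (hr : algebraMap R V r ≠ 0)
    (hrV : ∀ v : V, ∃ s : R, algebraMap R V s = algebraMap R V r * v)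
    (hres : ∀ v : V, ∃ a : R, v - algebraMap R V a ∈ IsLocalRing.maximalIdeal V) {c : ℕ}
    (hc : ∀ m, c ≤ m → m ∈ valueSemigroup R V) (v : V)
    (hv : v ∈ IsLocalRing.maximalIdeal V ^ c) : ∃ s : R, algebraMap R V s = v := by
  obtain ⟨N, hN⟩ := ENat.ne_top_iff_exists.1 (mt addVal_eq_top_iff.1 hr)
  have step : ∀ d m : ℕ, c ≤ m → N ≤ m + d → ∀ v ∈ IsLocalRing.maximalIdeal V ^ m,
      ∃ s : R, algebraMap R V s = v := by
    intro d
    induction d with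
    | zero =>
      intro m _ hNm v hv
      rw [mem_maximalIdeal_pow_iff_le_addVal] at hv
      have : addVal V (algebraMap R V r) ≤ addVal V v := by
        rw [← hN]
        exact le_trans (by exact_mod_cast hNm) hv
      obtain ⟨u, rfl⟩ := addVal_le_iff_dvd.1 this
      exact hrV u
    | succ d ih =>
      intro m hm hNm v hv
      obtain ⟨t, ht⟩ := hc m hm
      rw [mem_maximalIdeal_pow_iff_le_addVal, ← ht, addVal_le_iff_dvd] at hv
      obtain ⟨u, rfl⟩ := hv
      obtain ⟨a, ha⟩ := hres u
      have htm : algebraMap R V t ∈ IsLocalRing.maximalIdeal V ^ m :=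
        mem_maximalIdeal_pow_iff_le_addVal.2 ht.ge
      obtain ⟨s, hs⟩ := ih (m + 1) (by omega) (by omega) _
        (by rw [pow_succ]; exact Ideal.mul_mem_mul htm ha)
      exact ⟨s + t * a, by rw [map_add, map_mul, hs]; ring⟩
  exact step N c le_rfl (Nat.le_add_left N c) v hv

end Conductor

/-! ### The number of star operations -/

theorem mainTheorem4 {R V K : Type*} [CommRing R] [IsLocalRing R] [CommRing V] [IsDomain V]
    [IsDiscreteValuationRing V] [Field K] [Algebra R V] [Algebra R K] [Algebra V K]
    [IsScalarTower R V K] [IsFractionRing R K] (hR : IsKunzDomain R V K)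
    (n : ℕ) (hn : 4 ≤ n)
    (hval : valueSemigroup R V = AddSubmonoid.closure (Set.Icc n (2 * n - 3) ∪ {2 * n - 1}))
    [Finite (IsLocalRing.ResidueField R)]
    (q : ℕ) (hq : Nat.card (IsLocalRing.ResidueField R) = q) :
    ((2 ^ ((q ^ (n - 2) - 1) / (q - 1)) : ℕ) : Cardinal) ≤ Cardinal.mk (starOperations R K) ∧
      (2 : ℕ) ^ q ^ (n - 3) ≤ 2 ^ ((q ^ (n - 2) - 1) / (q - 1)) := by
  have hq2 : 2 ≤ q := hq ▸ Finite.one_lt_card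
  refine ⟨?_, ?_⟩
  swap
  · refine Nat.pow_le_pow_right (by norm_num) ?_
    rw [← Nat.geomSum_eq hq2]
    exact Finset.single_le_sum (f := fun i => q ^ i) (fun _ _ => Nat.zero_le _)
      (Finset.mem_range.2 (by omega))
  have hloc := hR.isLocalHom
  have hVK : Function.Injective (algebraMap V K) := hR.isIntegralClosure.algebraMap_injective
  have hRV : Function.Injective (algebraMap R V) := by
    have := IsFractionRing.injective R K
    rw [IsScalarTower.algebraMap_eq R V K] at this
    exact Function.Injective.of_comp this
  have hqV : Nat.card (IsLocalRing.ResidueField V) = q := by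
    rw [← hq]
    exact (Nat.card_congr (Equiv.ofBijective _ hR.residueField_bijective)).symm
  have hres : ∀ v : V, ∃ a : R, v - algebraMap R V a ∈ IsLocalRing.maximalIdeal V := by
    intro v
    obtain ⟨a, ha⟩ := hR.residueField_bijective.2 (IsLocalRing.residue V v)
    obtain ⟨a, rfl⟩ := IsLocalRing.residue_surjective a
    rw [IsLocalRing.ResidueField.map_residue] at ha
    exact ⟨a, by rw [← IsLocalRing.residue_eq_zero_iff, map_sub, ha, sub_self]⟩
  obtain ⟨r, hr, hrV⟩ : ∃ r : R, algebraMap R V r ≠ 0 ∧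
      ∀ v : V, ∃ s : R, algebraMap R V s = algebraMap R V r * v := by
    obtain ⟨x, hx0, hx⟩ := hR.conductor_ne_zero
    obtain ⟨r, hr⟩ := hx 1
    rw [map_one, mul_one] at hr
    subst hr
    refine ⟨r, fun h => hx0 (by rw [IsScalarTower.algebraMap_apply R V K, h, map_zero]),
      fun v => ?_⟩
    obtain ⟨s, hs⟩ := hx v
    exact ⟨s, hVK (by rw [map_mul, ← IsScalarTower.algebraMap_apply,
      ← IsScalarTower.algebraMap_apply, hs])⟩
  have hrD : r ∈ R⁰ := by
    have := hRV.isDomain (algebraMap R V)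
    exact mem_nonZeroDivisors_of_ne_zero fun h => hr (by rw [h, map_zero])
  have hM : ∀ r ∈ IsLocalRing.maximalIdeal R,
      algebraMap R V r ∈ IsLocalRing.maximalIdeal V ^ n := by
    intro r hr
    rw [mem_maximalIdeal_pow_iff_le_addVal]
    obtain h | ⟨m, h⟩ := (eq_or_ne (IsDiscreteValuationRing.addVal V (algebraMap R V r)) ⊤).imp_right
      ENat.ne_top_iff_exists.1
    · rw [h]
      exact le_top
    · have hm : m ∈ valueSemigroup R V := ⟨r, h.symm⟩
      rw [hval] at hm
      rw [← h]
      refine Nat.cast_le.2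
        ((AddSubmonoid.closure_Icc_union_singleton_eq_zero_or_le (by omega) hm).resolve_left ?_)
      rintro rfl
      rw [eq_comm, Nat.cast_zero, IsDiscreteValuationRing.addVal_eq_zero_iff,
        isUnit_map_iff] at h
      exact (IsLocalRing.mem_maximalIdeal r).1 hr h
  have hC := exists_algebraMap_eq_of_mem_maximalIdeal_pow hr hrV hres (c := 2 * n - 1)
    fun m hm => hval ▸ AddSubmonoid.mem_closure_Icc_union_singleton_of_le hn m hm
  -- An element `p` of value `n - 1` separates every `R + R w + 𝔪ⁿ` from the star operation
  -- generated by the others.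
  obtain ⟨p, hp, hp'⟩ := SetLike.exists_of_lt
    (Ideal.pow_succ_lt_pow (IsDiscreteValuationRing.not_a_field V) (n - 1))
  rw [show n - 1 + 1 = n by omega] at hp'
  obtain ⟨t, htw, ht, hcard⟩ := exists_pairwise_not_moebius (by omega) hM hq hqV hq2
  choose w hw hw1 hwb using fun b : t => htw b b.2
  have hfrac := fun b : t => isFractional_pairSubmodule (K := K) hrD hrV
    (Ideal.Quotient.mk (IsLocalRing.maximalIdeal V ^ n) (w b))
  refine le_trans (Nat.cast_le.2 (Nat.pow_le_pow_right (by norm_num) hcard)) ?_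
  have := two_pow_card_le_mk_starOperations (ι := t)
    (fun b => (⟨_, hfrac b⟩ : FractionalIdeal R⁰ K)) (fun _ => algebraMap V K p)
    (fun b => by
      change (1 : K) ∈ pairSubmodule R K _
      rw [← map_one (algebraMap V K), algebraMap_mem_pairSubmodule hVK]
      exact ⟨1, 0, by simp⟩)
    (fun b => algebraMap_notMem_pairSubmodule hVK (by omega) hM (hw b) (hw1 b) hp hp')
    (fun b x hx => (FractionalIdeal.mem_one_iff _).2
      (exists_algebraMap_eq_mul_of_forall_mem_pairSubmodule hVK (by omega) hM hC (hw b) (hw1 b) hp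
        fun z hz => (FractionalIdeal.mem_one_iff _).1 (hx z hz)))
    (fun b b' hbb' x hx => mul_mem_pairSubmodule_of_not_moebius hVK (by omega) hM (hw b) (hw1 b)
      (hw b') (fun h => hbb' (Subtype.ext (ht b b.2 b' b'.2 (by rwa [hwb, hwb] at h)))) hp hx)
  rwa [Nat.card_eq_fintype_card, Fintype.card_coe] at this
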